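/- Write $\langle X,Y\rangle=\operatorname{tr}(XY^T)$ on $\mathbb R^{3\times3}$, $\operatorname{sym}X=\tfrac12(X+X^T)$, $\operatorname{skew}X=\tfrac12(X-X^T)$; let $\mathrm{GL}^+(3)$ be the matrices with positive determinant and $\mathrm{Sym}(3)$ the symmetric ones. Consider an isotropic hyperelastic material, i.e. a stored energy $\mathrm W:\mathrm{GL}^+(3)\to\mathbb R$ that is twice differentiable and satisfies $\mathrm W(Q_1^TFQ_2)=\mathrm W(F)$ for all $F\in\mathrm{GL}^+(3)$ and $Q_1,Q_2\in\mathrm{SO}(3)$. Its Cauchy stress is $\sigma(F)=\frac1{\det F}\,\mathrm D_F\mathrm W(F)\,F^T$. With $V=\sqrt{FF^T}$, the stress is symmetric and depends on $\log V$ only: $\sigma(F)=\widehat\sigma(\log V)$, where $\widehat\sigma:\mathrm{Sym}(3)\to\mathrm{Sym}(3)$, $\widehat\sigma(X)=\sigma(\exp X)$, is differentiable. For a differentiable history $t\mapsto F(t)\in\mathrm{GL}^+(3)$ of the deformation gradient at a material point put $L=\dot FF^{-1}$, $D=\operatorname{sym}L$, $W=\operatorname{skew}L$, and let $\frac{\mathrm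 D^{\mathrm{ZJ}}}{\mathrm Dt}[\sigma]=\frac{\mathrm d}{\mathrm dt}[\sigma]+\sigma W-W\sigma$ be the Zaremba–Jaumann rate of $\sigma=\sigma(F(t))$. The corotational stability postulate (CSP) holds in the state $F_0\in\mathrm{GL}^+(3)$ if $\langle\frac{\mathrm D^{\mathrm{ZJ}}}{\mathrm Dt}[\sigma],D\rangle>0$ at time $t$ for every such history and every $t$ with $F(t)=F_0$ and $D(t)\neq0$; CSP holds if it holds in every state. Then CSP is equivalent to the strong Hilbert-monotonicity of $\widehat\sigma$ in $\log V$, which is TSTS-M$^{++}$: the symmetric part $\operatorname{sym}\mathrm D_{\log V}\widehat\sigma(\log V)$ is positive definite on $\mathrm{Sym}(3)$ for every $\log V\in\mathrm{Sym}(3)$. The equivalence also holds state by state: for each $F\in\mathrm{GL}^+(3)$, CSP holds in the state $F$ if and only if $\operatorname{sym}\mathrm D_{\log V}\widehat\sigma(\log V)$ is positive definite at $V=\sqrt{FF^T}$. -/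

import Mathlib

open scoped Matrix Matrix.Norms.Frobenius

noncomputable section

/-- Real `3 × 3` matrices (second order tensors); the norm in force is the Frobenius norm. -/
abbrev M3 : Type := Matrix (Fin 3) (Fin 3) ℝ

/-- The scalar product `⟨X, Y⟩ = tr (X Yᵀ)`. -/
def frobInner (X Y : M3) : ℝ := (X * Yᵀ).trace

/-- `GL⁺(3)`. -/
def GLPlus3 : Set M3 := {F | 0 < F.det}

/-- `Sym(3)`. -/
def Sym3 : Submodule ℝ M3 where
  carrier := {X | Xᵀ = X}
  add_mem' := by
    intro X Y hX hY
    have hX' : Xᵀ = X := hX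
    have hY' : Yᵀ = Y := hY
    change (X + Y)ᵀ = X + Y
    rw [Matrix.transpose_add, hX', hY']
  zero_mem' := Matrix.transpose_zero
  smul_mem' := by
    intro c X hX
    have hX' : Xᵀ = X := hX
    change (c • X)ᵀ = c • X
    rw [Matrix.transpose_smul, hX']

def symPart (X : M3) : M3 := (1 / 2 : ℝ) • (X + Xᵀ)

def skewPart (X : M3) : M3 := (1 / 2 : ℝ) • (X - Xᵀ)

/-- An isotropic hyperelastic material: a stored energy `W` on `GL⁺(3)`, twice Fréchet
differentiable there, which is objective and isotropic. Values of `W` off `GL⁺(3)` play no role. -/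
structure IsIsotropicHyperelastic (W : M3 → ℝ) : Prop where
  differentiableOn : DifferentiableOn ℝ W GLPlus3
  differentiableOn_fderiv : DifferentiableOn ℝ (fderiv ℝ W) GLPlus3
  invariant : ∀ F ∈ GLPlus3, ∀ Q₁ ∈ Matrix.specialOrthogonalGroup (Fin 3) ℝ,
    ∀ Q₂ ∈ Matrix.specialOrthogonalGroup (Fin 3) ℝ, W (Q₁ᵀ * F * Q₂) = W F

/-- First Piola-Kirchhoff stress `S₁ = D_F W(F)`: the matrix with `⟨S₁, H⟩ = DW(F).H`. -/
def piola1 (W : M3 → ℝ) (F : M3) : M3 :=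
  Matrix.of fun i j => fderiv ℝ W F (Matrix.single i j 1)

/-- Cauchy stress `σ = J⁻¹ S₁ Fᵀ` with `J = det F`. -/
def cauchyStress (W : M3 → ℝ) (F : M3) : M3 :=
  (F.det)⁻¹ • (piola1 W F * Fᵀ)

/-- Left stretch `V = √(F Fᵀ)`. -/
def leftStretch (F : M3) : M3 := cfc Real.sqrt (F * Fᵀ)

/-- The spatial logarithmic strain `log V`, as an element of `Sym(3)`. -/
def logV (F : M3) : Sym3 :=
  ⟨cfc Real.log (leftStretch F), by
    have h : IsSelfAdjoint (cfc Real.log (leftStretch F)) := cfc_predicate _ _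
    have h' : (cfc Real.log (leftStretch F))ᴴ = cfc Real.log (leftStretch F) := h
    rwa [Matrix.conjTranspose_eq_transpose_of_trivial] at h'⟩

/-- The Cauchy stress as a function `σ̂` of the logarithmic strain `X = log V`: the stress in the
state with deformation gradient `V = exp X`. -/
def cauchyHat (W : M3 → ℝ) (X : Sym3) : M3 :=
  cauchyStress W (NormedSpace.exp (X : M3))

/-- `L = Ḟ F⁻¹` at time `t`, for a history `F` of the deformation gradient at a material point. -/
def velocityGradient (F : ℝ → M3) (t : ℝ) : M3 := deriv F t * (F t)⁻¹

/-- `D = sym L`. -/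
def stretching (F : ℝ → M3) (t : ℝ) : M3 := symPart (velocityGradient F t)

/-- `W = skew L`. -/
def vorticity (F : ℝ → M3) (t : ℝ) : M3 := skewPart (velocityGradient F t)

/-- The Zaremba-Jaumann rate of `T` along the history `F`: `Ṫ + T W - W T`. -/
def zarembaJaumann (F T : ℝ → M3) (t : ℝ) : M3 :=
  deriv T t + T t * vorticity F t - vorticity F t * T t

/-- The corotational stability postulate in the state `F₀`: along every history of the deformation
gradient passing through `F₀` at a time `t` with `D ≠ 0`, the Zaremba-Jaumann rate of the Cauchy
stress has positive scalar product with `D`. -/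
def CSPAt (W : M3 → ℝ) (F₀ : M3) : Prop :=
  ∀ F : ℝ → M3, Differentiable ℝ F → (∀ s, F s ∈ GLPlus3) → ∀ t, F t = F₀ →
    stretching F t ≠ 0 →
      0 < frobInner (zarembaJaumann F (fun s => cauchyStress W (F s)) t) (stretching F t)

/-- The corotational stability postulate (CSP). -/
def CSP (W : M3 → ℝ) : Prop := ∀ F₀ ∈ GLPlus3, CSPAt W F₀

/-- The bilinear form `(H, K) ↦ ⟨(sym Dσ̂(X)).H, K⟩` on `Sym(3)`. -/
def symTangent (W : M3 → ℝ) (X H K : Sym3) : ℝ :=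
  (frobInner (fderiv ℝ (cauchyHat W) X H) K + frobInner (fderiv ℝ (cauchyHat W) X K) H) / 2

/-- `sym Dσ̂(X)` is positive definite on `Sym(3)`. -/
def SymTangentPosDef (W : M3 → ℝ) (X : Sym3) : Prop :=
  ∀ H : Sym3, H ≠ 0 → 0 < symTangent W X H H

/-- TSTS-M⁺⁺, i.e. strong Hilbert-monotonicity of `σ̂`: positive definiteness at every
logarithmic strain. -/
def TSTSMpp (W : M3 → ℝ) : Prop := ∀ X : Sym3, SymTangentPosDef W X

end

/-! Both conditions say that a quadratic form on `Sym3` is positive definite. Write L = D + W.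
Objectivity gives Dσ(F).(WF) = Wσ - σW, which cancels the corotational terms, so the Zaremba-Jaumann
rate is Dσ(F).(DF). Every symmetric D occurs in some history through F, so CSP at F is positivity of
H ↦ ⟨Dσ(F).(HF), H⟩ (`CSPAt_iff`), to be compared with H ↦ ⟨Dσ̂(log V).H, H⟩.

By covariance under rotations both forms may be examined at F = V = exp(diag x). There they are
invariant under the half turns about the axes, so each splits into a form on diagonal matrices plus
one square per shear (`HalfTurnInvariant.apply_self`). On diagonal matrices the forms agree, since
these commute with log V. On a shear with x i ≠ x j both values are multiples of one quantity, the
change Aσ - σA of the stress under an infinitesimal rotation A. With l = exp x, this gives (x j - x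
i) · tangent = (l j² - l i²)/(l i² + l j²) · stress (`tangentForm_symShear`). The two factors have
the same sign because exp is increasing; for x i = x j the shear commutes with log V and the values
agree. The forms are thus positive definite together, state by state, although they differ in
general. -/

noncomputable section

/-! ### Rotations, `GLPlus3` and the matrix exponential -/

/-- The rotation group `SO(3)`. -/
abbrev SO3 : Submonoid M3 := Matrix.specialOrthogonalGroup (Fin 3) ℝ

theorem SO3.mul_transpose {Q : M3} (hQ : Q ∈ SO3) : Q * Qᵀ = 1 :=
  (Matrix.mem_orthogonalGroup_iff _ _).1 (Matrix.mem_specialOrthogonalGroup_iff.1 hQ).1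

theorem SO3.transpose_mul {Q : M3} (hQ : Q ∈ SO3) : Qᵀ * Q = 1 :=
  mul_eq_one_comm.1 (SO3.mul_transpose hQ)

theorem SO3.det_eq_one {Q : M3} (hQ : Q ∈ SO3) : Q.det = 1 :=
  (Matrix.mem_specialOrthogonalGroup_iff.1 hQ).2

theorem mem_SO3 {Q : M3} (h : Q * Qᵀ = 1) (hd : Q.det = 1) : Q ∈ SO3 :=
  Matrix.mem_specialOrthogonalGroup_iff.2 ⟨(Matrix.mem_orthogonalGroup_iff _ _).2 h, hd⟩

theorem SO3.transpose_mem {Q : M3} (hQ : Q ∈ SO3) : Qᵀ ∈ SO3 :=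
  mem_SO3 (by rw [Matrix.transpose_transpose, SO3.transpose_mul hQ])
    (by rw [Matrix.det_transpose, SO3.det_eq_one hQ])

theorem SO3.inv_eq {Q : M3} (hQ : Q ∈ SO3) : Q⁻¹ = Qᵀ :=
  Matrix.inv_eq_right_inv (SO3.mul_transpose hQ)

theorem mem_Sym3 {X : M3} : X ∈ Sym3 ↔ Xᵀ = X := Iff.rfl

theorem Sym3.transpose_coe (X : Sym3) : (X : M3)ᵀ = X := X.2

theorem mem_GLPlus3 {F : M3} : F ∈ GLPlus3 ↔ 0 < F.det := Iff.rfl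

theorem isOpen_GLPlus3 : IsOpen GLPlus3 :=
  isOpen_lt continuous_const (Continuous.matrix_det continuous_id)

theorem GLPlus3.mul_mem {F G : M3} (hF : F ∈ GLPlus3) (hG : G ∈ GLPlus3) :
    F * G ∈ GLPlus3 := by
  rw [mem_GLPlus3, Matrix.det_mul]; exact mul_pos hF hG

theorem SO3.mem_GLPlus3 {Q : M3} (hQ : Q ∈ SO3) : Q ∈ GLPlus3 := by
  rw [_root_.mem_GLPlus3, SO3.det_eq_one hQ]; exact one_pos

/-- The exponential is the square of the invertible matrix exp(X/2), so its determinant is a nonzero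
square. -/
theorem exp_mem_GLPlus3 (X : M3) : NormedSpace.exp X ∈ GLPlus3 := by
  have h : NormedSpace.exp X
      = NormedSpace.exp ((1 / 2 : ℝ) • X) * NormedSpace.exp ((1 / 2 : ℝ) • X) := by
    rw [← Matrix.exp_add_of_commute _ _ (Commute.refl _), ← add_smul]
    norm_num
  have hu : ((NormedSpace.exp ((1 / 2 : ℝ) • X) : M3)).det ≠ 0 :=
    ((Matrix.isUnit_iff_isUnit_det _).1 (Matrix.isUnit_exp ((1 / 2 : ℝ) • X))).ne_zero
  rw [mem_GLPlus3, h, Matrix.det_mul]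
  exact mul_self_pos.2 hu

theorem exp_mem_SO3 {A : M3} (hA : Aᵀ = -A) : NormedSpace.exp A ∈ SO3 := by
  have h : NormedSpace.exp A * (NormedSpace.exp A)ᵀ = 1 := by
    rw [← Matrix.exp_transpose, hA,
      ← Matrix.exp_add_of_commute _ _ ((Commute.refl A).neg_right), add_neg_cancel,
      NormedSpace.exp_zero]
  refine mem_SO3 h ?_
  have h2 := congrArg Matrix.det h
  rw [Matrix.det_mul, Matrix.det_transpose, Matrix.det_one] at h2
  have h3 : 0 < (NormedSpace.exp A : M3).det := exp_mem_GLPlus3 A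
  nlinarith

theorem hasDerivAt_exp_smul_zero (A : M3) :
    HasDerivAt (fun s : ℝ => (NormedSpace.exp (s • A) : M3)) A 0 := by
  have h := hasDerivAt_exp_smul_const (𝕂 := ℝ) A 0
  rw [zero_smul, NormedSpace.exp_zero, one_mul] at h
  exact h

/-! ### The scalar product -/

theorem frobInner_eq_sum (X Y : M3) : frobInner X Y = ∑ i, ∑ j, X i j * Y i j := by
  simp [frobInner, Matrix.trace, Matrix.mul_apply]

theorem frobInner_conj {Q R : M3} (hQ : Q ∈ SO3) (hR : R ∈ SO3) (X Y : M3) :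
    frobInner (Q * X * R) (Q * Y * R) = frobInner X Y := by
  unfold frobInner
  rw [Matrix.transpose_mul, Matrix.transpose_mul]
  have : Q * X * R * (Rᵀ * (Yᵀ * Qᵀ)) = Q * (X * (R * Rᵀ) * (Yᵀ * Qᵀ)) := by
    simp only [Matrix.mul_assoc]
  rw [this, SO3.mul_transpose hR, Matrix.mul_one, Matrix.trace_mul_comm,
    ← Matrix.mul_assoc, Matrix.mul_assoc, SO3.transpose_mul hQ, Matrix.mul_one]

theorem eq_of_frobInner_eq {X Y : M3} (h : ∀ K, frobInner X K = frobInner Y K) : X = Y := by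
  ext i j
  have := h (Matrix.single i j 1)
  simpa [frobInner_eq_sum, Matrix.single_apply, ite_and] using this

/-! ### Covariance of the stress -/

theorem fderiv_eq_frobInner_piola1 (W : M3 → ℝ) (F K : M3) :
    fderiv ℝ W F K = frobInner (piola1 W F) K := by
  conv_lhs => rw [Matrix.matrix_eq_sum_single K]
  rw [frobInner_eq_sum, map_sum]
  refine Finset.sum_congr rfl fun i _ => ?_
  rw [map_sum]
  refine Finset.sum_congr rfl fun j _ => ?_
  have : (Matrix.single i j (K i j) : M3) = K i j • Matrix.single i j 1 := by
    rw [Matrix.smul_single, smul_eq_mul, mul_one]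
  rw [this, map_smul, smul_eq_mul, mul_comm]
  rfl

/-- Left-right multiplication `K ↦ P K R` as a continuous linear map. -/
def mulLR (P R : M3) : M3 →L[ℝ] M3 :=
  LinearMap.toContinuousLinearMap
    ((LinearMap.mulRight ℝ R).comp (LinearMap.mulLeft ℝ P))

@[simp] theorem mulLR_apply (P R K : M3) : mulLR P R K = P * K * R := rfl

variable {W : M3 → ℝ}

theorem IsIsotropicHyperelastic.differentiableAt (hW : IsIsotropicHyperelastic W) {F : M3}
    (hF : F ∈ GLPlus3) : DifferentiableAt ℝ W F :=
  hW.differentiableOn.differentiableAt (isOpen_GLPlus3.mem_nhds hF)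

theorem IsIsotropicHyperelastic.map_conj (hW : IsIsotropicHyperelastic W) {F Q R : M3}
    (hF : F ∈ GLPlus3) (hQ : Q ∈ SO3) (hR : R ∈ SO3) : W (Q * F * R) = W F := by
  simpa using hW.invariant F hF Qᵀ (SO3.transpose_mem hQ) R hR

/-- Differentiate W(QGR) = W(G) near F; the map K ↦ QKR is an isometry for `frobInner`, so its
adjoint is its inverse. -/
theorem piola1_conj (hW : IsIsotropicHyperelastic W) {F Q R : M3}
    (hF : F ∈ GLPlus3) (hQ : Q ∈ SO3) (hR : R ∈ SO3) :
    piola1 W (Q * F * R) = Q * piola1 W F * R := by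
  have hF' : Q * F * R ∈ GLPlus3 := GLPlus3.mul_mem (GLPlus3.mul_mem (SO3.mem_GLPlus3 hQ) hF) (SO3.mem_GLPlus3 hR)
  have h1 : HasFDerivAt (fun G => W (mulLR Q R G))
      ((fderiv ℝ W (Q * F * R)).comp (mulLR Q R)) F :=
    HasFDerivAt.comp F (g := W) (hW.differentiableAt hF').hasFDerivAt (mulLR Q R).hasFDerivAt
  have h2 : (fun G => W (mulLR Q R G)) =ᶠ[nhds F] W := by
    filter_upwards [isOpen_GLPlus3.mem_nhds hF] with G hG
    exact hW.map_conj hG hQ hR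
  have h3 := (h1.congr_of_eventuallyEq h2.symm).unique (hW.differentiableAt hF).hasFDerivAt
  refine eq_of_frobInner_eq fun K => ?_
  obtain ⟨K, rfl⟩ : ∃ K', K = Q * K' * R := ⟨Qᵀ * K * Rᵀ, by
    have : Q * (Qᵀ * K * Rᵀ) * R = (Q * Qᵀ) * K * (Rᵀ * R) := by simp only [Matrix.mul_assoc]
    rw [this, SO3.mul_transpose hQ, SO3.transpose_mul hR, Matrix.one_mul, Matrix.mul_one]⟩
  rw [frobInner_conj hQ hR, ← fderiv_eq_frobInner_piola1, ← fderiv_eq_frobInner_piola1, ← h3]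
  rfl

theorem cauchyStress_conj (hW : IsIsotropicHyperelastic W) {F Q R : M3}
    (hF : F ∈ GLPlus3) (hQ : Q ∈ SO3) (hR : R ∈ SO3) :
    cauchyStress W (Q * F * R) = Q * cauchyStress W F * Qᵀ := by
  unfold cauchyStress
  rw [piola1_conj hW hF hQ hR, Matrix.det_mul, Matrix.det_mul, SO3.det_eq_one hQ,
    SO3.det_eq_one hR, one_mul, mul_one, Matrix.transpose_mul, Matrix.transpose_mul,
    Matrix.mul_smul, Matrix.smul_mul]
  congr 1
  have : Q * piola1 W F * R * (Rᵀ * (Fᵀ * Qᵀ)) = Q * piola1 W F * (R * Rᵀ) * (Fᵀ * Qᵀ) := by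
    simp only [Matrix.mul_assoc]
  rw [this, SO3.mul_transpose hR, Matrix.mul_one]
  simp only [Matrix.mul_assoc]

theorem cauchyStress_mul_left (hW : IsIsotropicHyperelastic W) {F Q : M3}
    (hF : F ∈ GLPlus3) (hQ : Q ∈ SO3) :
    cauchyStress W (Q * F) = Q * cauchyStress W F * Qᵀ := by
  simpa using cauchyStress_conj hW hF hQ (one_mem SO3)

theorem cauchyStress_mul_right (hW : IsIsotropicHyperelastic W) {F R : M3}
    (hF : F ∈ GLPlus3) (hR : R ∈ SO3) :
    cauchyStress W (F * R) = cauchyStress W F := by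
  simpa using cauchyStress_conj hW hF (one_mem SO3) hR

/-- W is constant along exp(sA)F for skew A. Hence ⟨S₁, AF⟩ = ⟨S₁Fᵀ, A⟩ = 0: the matrix S₁Fᵀ is
orthogonal to all skew matrices. -/
theorem cauchyStress_mem_Sym3 (hW : IsIsotropicHyperelastic W) {F : M3} (hF : F ∈ GLPlus3) :
    cauchyStress W F ∈ Sym3 := by
  have key : ∀ A : M3, Aᵀ = -A → frobInner (piola1 W F) (A * F) = 0 := by
    intro A hA
    have h1 : HasDerivAt (fun s : ℝ => mulLR 1 F (NormedSpace.exp (s • A))) (mulLR 1 F A) 0 :=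
      (mulLR 1 F).hasFDerivAt.comp_hasDerivAt (0 : ℝ) (hasDerivAt_exp_smul_zero A)
    have hF0 : mulLR 1 F (NormedSpace.exp ((0 : ℝ) • A)) = F := by
      simp
    have h2 : HasDerivAt (fun s : ℝ => W (mulLR 1 F (NormedSpace.exp (s • A))))
        (fderiv ℝ W F (mulLR 1 F A)) 0 := by
      refine HasFDerivAt.comp_hasDerivAt (0 : ℝ) (l := W) ?_ h1
      rw [hF0]
      exact (hW.differentiableAt hF).hasFDerivAt
    have h3 : (fun s : ℝ => W (mulLR 1 F (NormedSpace.exp (s • A)))) = fun _ => W F := by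
      funext s
      have hs : NormedSpace.exp (s • A) ∈ SO3 := exp_mem_SO3 (by
        rw [Matrix.transpose_smul, hA, smul_neg])
      simpa using hW.map_conj hF hs (one_mem SO3)
    rw [h3] at h2
    have h4 := h2.unique (hasDerivAt_const (0 : ℝ) (W F))
    rw [fderiv_eq_frobInner_piola1] at h4
    simpa using h4
  have hsymm : piola1 W F * Fᵀ ∈ Sym3 := by
    rw [mem_Sym3]
    ext i j
    -- This skew matrix picks out the difference of the (i, j) and (j, i) entries.
    have h := key (Matrix.single i j 1 - Matrix.single j i 1) (by simp)
    rw [frobInner, Matrix.transpose_mul, ← Matrix.mul_assoc, Matrix.transpose_sub,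
      Matrix.transpose_single, Matrix.transpose_single, Matrix.mul_sub, Matrix.trace_sub,
      Matrix.trace_mul_single, Matrix.trace_mul_single] at h
    simp at h
    rw [Matrix.transpose_apply]
    linarith
  exact Sym3.smul_mem _ hsymm

/-! ### Differentiability of the stress -/

theorem differentiable_entry (i j : Fin 3) : Differentiable ℝ fun F : M3 => F i j :=
  (LinearMap.toContinuousLinearMap (Matrix.entryLinearMap ℝ ℝ i j : M3 →ₗ[ℝ] ℝ)).differentiable

theorem differentiable_det : Differentiable ℝ fun F : M3 => F.det := by
  simp only [Matrix.det_fin_three]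
  have := differentiable_entry
  fun_prop

theorem cauchyStress_differentiableAt (hW : IsIsotropicHyperelastic W) {F : M3}
    (hF : F ∈ GLPlus3) : DifferentiableAt ℝ (cauchyStress W) F := by
  have hd : DifferentiableAt ℝ (fderiv ℝ W) F :=
    hW.differentiableOn_fderiv.differentiableAt (isOpen_GLPlus3.mem_nhds hF)
  have hp : DifferentiableAt ℝ (piola1 W) F := by
    have h : piola1 W = fun G => ∑ i, ∑ j,
        (fderiv ℝ W G (Matrix.single i j 1)) • (Matrix.single i j 1 : M3) := by
      funext G
      conv_lhs => rw [Matrix.matrix_eq_sum_single (piola1 W G)]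
      simp [piola1, Matrix.smul_single]
    rw [h]
    refine DifferentiableAt.fun_sum fun i _ => DifferentiableAt.fun_sum fun j _ => ?_
    exact (hd.clm_apply (differentiableAt_const _)).smul_const _
  have ht : DifferentiableAt ℝ (fun G : M3 => Gᵀ) F :=
    (LinearMap.toContinuousLinearMap
      (Matrix.transposeLinearEquiv (Fin 3) (Fin 3) ℝ ℝ).toLinearMap).differentiableAt
  have h1 : DifferentiableAt ℝ (fun G : M3 => (G.det)⁻¹) F :=
    (differentiable_det F).inv (ne_of_gt hF)
  exact h1.smul (hp.mul ht)

theorem cauchyHat_differentiable (hW : IsIsotropicHyperelastic W) :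
    Differentiable ℝ (cauchyHat W) := by
  intro X
  have he : DifferentiableAt ℝ (NormedSpace.exp : M3 → M3) (Sym3.subtypeL X) :=
    (NormedSpace.exp_analytic (𝕂 := ℝ) (X : M3)).differentiableAt
  have h2 := he.comp X (Sym3.subtypeL.differentiableAt)
  exact DifferentiableAt.comp X (g := cauchyStress W) (f := fun X : Sym3 => NormedSpace.exp (X : M3))
    (cauchyStress_differentiableAt hW (exp_mem_GLPlus3 _)) h2

/-! ### Spectral decomposition and the logarithmic strain -/

theorem isSelfAdjoint_of_mem_Sym3 {X : M3} (hX : X ∈ Sym3) : IsSelfAdjoint X := by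
  change Xᴴ = X
  rw [Matrix.conjTranspose_eq_transpose_of_trivial]; exact hX

theorem exists_SO3_diagonalization {X : M3} (hX : X ∈ Sym3) :
    ∃ Q ∈ SO3, ∃ x : Fin 3 → ℝ, X = Q * Matrix.diagonal x * Qᵀ ∧
      ∀ f : ℝ → ℝ, cfc f X = Q * Matrix.diagonal (fun i => f (x i)) * Qᵀ := by
  have hH : X.IsHermitian := isSelfAdjoint_of_mem_Sym3 hX
  set U : M3 := hH.eigenvectorUnitary.1
  have hUU : U * Uᵀ = 1 := by
    have := Unitary.coe_mul_star_self hH.eigenvectorUnitary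
    rwa [Unitary.coe_star, Matrix.star_eq_conjTranspose,
      Matrix.conjTranspose_eq_transpose_of_trivial] at this
  have h1 : X = U * Matrix.diagonal hH.eigenvalues * Uᵀ := by
    have h := hH.spectral_theorem
    rwa [Unitary.conjStarAlgAut_apply, Matrix.star_eq_conjTranspose,
      Matrix.conjTranspose_eq_transpose_of_trivial] at h
  have h2 : ∀ f : ℝ → ℝ, cfc f X = U * Matrix.diagonal (fun i => f (hH.eigenvalues i)) * Uᵀ := by
    intro f
    rw [hH.cfc_eq, Matrix.IsHermitian.cfc, Unitary.conjStarAlgAut_apply,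
      Matrix.star_eq_conjTranspose, Matrix.conjTranspose_eq_transpose_of_trivial]
    rfl
  have hdet : U.det = 1 ∨ U.det = -1 := by
    have h := congrArg Matrix.det hUU
    rw [Matrix.det_mul, Matrix.det_transpose, Matrix.det_one] at h
    exact mul_self_eq_one_iff.1 h
  rcases hdet with hdet | hdet
  · exact ⟨U, mem_SO3 hUU hdet, _, h1, h2⟩
  -- In odd dimension -U has the opposite determinant, and conjugation by -U is conjugation by U.
  · refine ⟨-U, mem_SO3 (by simpa using hUU) (by rw [Matrix.det_neg, hdet]; norm_num), _,
      by simpa using h1, fun f => by simpa using h2 f⟩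

theorem exp_SO3_conj {Q : M3} (hQ : Q ∈ SO3) (X : M3) :
    NormedSpace.exp (Q * X * Qᵀ) = Q * NormedSpace.exp X * Qᵀ := by
  have h := Matrix.exp_conj Q X
    ((Matrix.isUnit_iff_isUnit_det Q).2 (by rw [SO3.det_eq_one hQ]; exact isUnit_one))
  rwa [SO3.inv_eq hQ] at h

theorem exp_diagonal_real (x : Fin 3 → ℝ) :
    NormedSpace.exp (Matrix.diagonal x : M3) = Matrix.diagonal fun i => Real.exp (x i) := by
  rw [Matrix.exp_diagonal, Pi.exp_def]
  simp only [Real.exp_eq_exp_ℝ]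

theorem exp_eq_cfc_exp {X : M3} (hX : X ∈ Sym3) : NormedSpace.exp X = cfc Real.exp X := by
  obtain ⟨Q, hQ, x, h1, h2⟩ := exists_SO3_diagonalization hX
  rw [h2]
  conv_lhs => rw [h1]
  rw [exp_SO3_conj hQ, exp_diagonal_real]

/-- The spectrum is finite, so even functions discontinuous on ℝ, such as `Real.log`, are admissible
in the functional calculus. -/
theorem continuousOn_spectrum (f : ℝ → ℝ) (X : M3) : ContinuousOn f (spectrum ℝ X) :=
  (Matrix.finite_real_spectrum (A := X)).continuousOn f

theorem continuousOn_image_spectrum (g f : ℝ → ℝ) (X : M3) :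
    ContinuousOn g (f '' spectrum ℝ X) :=
  ((Matrix.finite_real_spectrum (A := X)).image f).continuousOn g

theorem cfc_comp_of_mem_Sym3 (g f : ℝ → ℝ) {X : M3} (hX : X ∈ Sym3) :
    cfc g (cfc f X) = cfc (fun x => g (f x)) X :=
  (cfc_comp g f X (isSelfAdjoint_of_mem_Sym3 hX) (continuousOn_image_spectrum g f X)
    (continuousOn_spectrum f X)).symm

theorem mul_transpose_mem_Sym3 (F : M3) : F * Fᵀ ∈ Sym3 := by
  rw [mem_Sym3, Matrix.transpose_mul, Matrix.transpose_transpose]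

theorem conj_diagonal_mul {Q : M3} (hQ : Q ∈ SO3) (x y : Fin 3 → ℝ) :
    (Q * Matrix.diagonal x * Qᵀ) * (Q * Matrix.diagonal y * Qᵀ)
      = Q * Matrix.diagonal (fun i => x i * y i) * Qᵀ := by
  have : (Q * Matrix.diagonal x * Qᵀ) * (Q * Matrix.diagonal y * Qᵀ)
      = Q * Matrix.diagonal x * (Qᵀ * Q) * (Matrix.diagonal y * Qᵀ) := by
    simp only [Matrix.mul_assoc]
  rw [this, SO3.transpose_mul hQ, Matrix.mul_one, ← Matrix.mul_assoc, Matrix.mul_assoc Q,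
    Matrix.diagonal_mul_diagonal]

/-- In an eigenbasis of FFᵀ, log V has entries log √dᵢ. The dᵢ are positive because F is invertible,
so exponentiating and squaring recovers dᵢ. -/
theorem exp_logV_sq {F : M3} (hF : F ∈ GLPlus3) :
    NormedSpace.exp (logV F : M3) * NormedSpace.exp (logV F : M3) = F * Fᵀ := by
  have hB := mul_transpose_mem_Sym3 F
  obtain ⟨Q, hQ, d, h1, h2⟩ := exists_SO3_diagonalization hB
  have hpd : (F * Fᵀ).PosDef := by
    have h := Matrix.PosDef.mul_conjTranspose_self F
      (Matrix.vecMul_injective_of_isUnit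
        ((Matrix.isUnit_iff_isUnit_det F).2 (ne_of_gt hF).isUnit))
    rwa [Matrix.conjTranspose_eq_transpose_of_trivial] at h
  have hd : ∀ i, 0 < d i := by
    have h := hpd.conjTranspose_mul_mul_same (B := Q)
      (Matrix.mulVec_injective_of_isUnit ((Matrix.isUnit_iff_isUnit_det Q).2
        (by rw [SO3.det_eq_one hQ]; exact isUnit_one)))
    rw [Matrix.conjTranspose_eq_transpose_of_trivial, h1] at h
    have h3 : Qᵀ * (Q * Matrix.diagonal d * Qᵀ) * Q = (Qᵀ * Q) * Matrix.diagonal d * (Qᵀ * Q) := by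
      simp only [Matrix.mul_assoc]
    rw [h3, SO3.transpose_mul hQ, Matrix.one_mul, Matrix.mul_one] at h
    exact Matrix.posDef_diagonal_iff.1 h
  have hl : (logV F : M3)
      = Q * Matrix.diagonal (fun i => Real.log (Real.sqrt (d i))) * Qᵀ := by
    change cfc Real.log (cfc Real.sqrt (F * Fᵀ)) = _
    rw [cfc_comp_of_mem_Sym3 _ _ hB, h2]
  rw [hl, exp_SO3_conj hQ, exp_diagonal_real, conj_diagonal_mul hQ]
  conv_rhs => rw [h1]
  congr 3
  funext i
  rw [Real.exp_log (Real.sqrt_pos.2 (hd i)), Real.mul_self_sqrt (hd i).le]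

theorem exp_mem_Sym3 {X : M3} (hX : X ∈ Sym3) : NormedSpace.exp X ∈ Sym3 := by
  rw [mem_Sym3, ← Matrix.exp_transpose, mem_Sym3.1 hX]

/-- Polar decomposition `F = V R` with `V = exp (log V)`. -/
theorem exists_polar {F : M3} (hF : F ∈ GLPlus3) :
    ∃ R ∈ SO3, F = NormedSpace.exp (logV F : M3) * R := by
  set V : M3 := NormedSpace.exp (logV F : M3) with hV
  have hVpos : 0 < V.det := exp_mem_GLPlus3 _
  have hVu : IsUnit V.det := hVpos.ne'.isUnit
  have hVt : Vᵀ = V := exp_mem_Sym3 (logV F).2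
  have hVV : V * V = F * Fᵀ := exp_logV_sq hF
  refine ⟨V⁻¹ * F, mem_SO3 ?_ ?_, ?_⟩
  · rw [Matrix.transpose_mul, Matrix.transpose_nonsing_inv, hVt]
    have : V⁻¹ * F * (Fᵀ * V⁻¹) = V⁻¹ * (F * Fᵀ) * V⁻¹ := by simp only [Matrix.mul_assoc]
    rw [this, ← hVV, ← Matrix.mul_assoc, Matrix.nonsing_inv_mul V hVu, Matrix.one_mul,
      Matrix.mul_nonsing_inv V hVu]
  · have h := congrArg Matrix.det hVV
    rw [Matrix.det_mul, Matrix.det_mul, Matrix.det_transpose] at h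
    have h2 : V.det = F.det := (mul_self_inj hVpos.le (le_of_lt hF)).1 h
    rw [Matrix.det_mul, Matrix.det_nonsing_inv, ← h2]
    exact Ring.inverse_mul_cancel _ hVu
  · rw [← Matrix.mul_assoc, Matrix.mul_nonsing_inv V hVu, Matrix.one_mul]

/-- Every element of `Sym3` is thus the logarithmic strain of some state, so CSP in all states
reaches all of `Sym3`. -/
theorem logV_exp (X : Sym3) : logV (NormedSpace.exp (X : M3)) = X := by
  have hX := X.2
  apply Subtype.ext
  change cfc Real.log (cfc Real.sqrt
    (NormedSpace.exp (X : M3) * (NormedSpace.exp (X : M3))ᵀ)) = X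
  rw [mem_Sym3.1 (exp_mem_Sym3 hX), exp_eq_cfc_exp hX,
    ← cfc_mul Real.exp Real.exp (X : M3) (continuousOn_spectrum _ _) (continuousOn_spectrum _ _),
    cfc_comp_of_mem_Sym3 _ _ hX, cfc_comp_of_mem_Sym3 _ _ hX]
  have h : (fun x : ℝ => Real.log (Real.sqrt (Real.exp x * Real.exp x))) = id := by
    funext x
    rw [Real.sqrt_mul_self (Real.exp_pos x).le, Real.log_exp, id]
  rw [h]
  exact cfc_id ℝ (X : M3) (isSelfAdjoint_of_mem_Sym3 hX)

theorem cauchyHat_logV (hW : IsIsotropicHyperelastic W) {F : M3} (hF : F ∈ GLPlus3) :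
    cauchyHat W (logV F) = cauchyStress W F := by
  obtain ⟨R, hR, h⟩ := exists_polar hF
  conv_rhs => rw [h]
  rw [cauchyStress_mul_right hW (exp_mem_GLPlus3 _) hR]
  rfl

/-! ### Derivatives of the stress -/

theorem smul_skew {A : M3} (hA : Aᵀ = -A) (s : ℝ) : (s • A)ᵀ = -(s • A) := by
  rw [Matrix.transpose_smul, hA, smul_neg]

theorem hasDerivAt_mulLR_exp (P R A : M3) :
    HasDerivAt (fun s : ℝ => P * NormedSpace.exp (s • A) * R) (P * A * R) 0 :=
  (mulLR P R).hasFDerivAt.comp_hasDerivAt (0 : ℝ) (hasDerivAt_exp_smul_zero A)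

theorem hasDerivAt_exp_conj {A : M3} (hA : Aᵀ = -A) (M : M3) :
    HasDerivAt (fun s : ℝ => NormedSpace.exp (s • A) * M * (NormedSpace.exp (s • A))ᵀ)
      (A * M - M * A) 0 := by
  have h1 := hasDerivAt_mulLR_exp 1 M A
  have h2 := hasDerivAt_exp_smul_zero (-A)
  have h3 := h1.mul h2
  simp only [zero_smul, NormedSpace.exp_zero, Matrix.one_mul, Matrix.mul_one, Matrix.mul_neg,
    ← sub_eq_add_neg] at h3
  refine h3.congr_of_eventuallyEq (Filter.Eventually.of_forall fun s => ?_)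
  simp only [Pi.mul_apply]
  rw [← Matrix.exp_transpose, smul_skew hA, smul_neg]

theorem hasDerivAt_cauchyStress_comp (hW : IsIsotropicHyperelastic W) {F : ℝ → M3} {F' : M3}
    {t : ℝ} (ht : F t ∈ GLPlus3) (h : HasDerivAt F F' t) :
    HasDerivAt (fun s => cauchyStress W (F s)) (fderiv ℝ (cauchyStress W) (F t) F') t :=
  (cauchyStress_differentiableAt hW ht).hasFDerivAt.comp_hasDerivAt t h

/-- Infinitesimal objectivity: differentiate σ(QF) = QσQᵀ along Q = exp(sA). -/
theorem fderiv_cauchyStress_skew_mul (hW : IsIsotropicHyperelastic W) {F : M3}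
    (hF : F ∈ GLPlus3) {A : M3} (hA : Aᵀ = -A) :
    fderiv ℝ (cauchyStress W) F (A * F) = A * cauchyStress W F - cauchyStress W F * A := by
  have h1 := hasDerivAt_mulLR_exp 1 F A
  have h2 := hasDerivAt_cauchyStress_comp hW (t := 0) (by simpa using hF) h1
  have h3 : (fun s : ℝ => cauchyStress W (1 * NormedSpace.exp (s • A) * F)) = fun s =>
      NormedSpace.exp (s • A) * cauchyStress W F * (NormedSpace.exp (s • A))ᵀ := by
    funext s
    rw [Matrix.one_mul, cauchyStress_mul_left hW hF (exp_mem_SO3 (smul_skew hA s))]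
  rw [h3] at h2
  simpa using h2.unique (hasDerivAt_exp_conj hA _)

/-- Infinitesimal isotropy: σ is constant along F exp(sA). -/
theorem fderiv_cauchyStress_mul_skew (hW : IsIsotropicHyperelastic W) {F : M3}
    (hF : F ∈ GLPlus3) {A : M3} (hA : Aᵀ = -A) :
    fderiv ℝ (cauchyStress W) F (F * A) = 0 := by
  have h1 := hasDerivAt_mulLR_exp F 1 A
  have h2 := hasDerivAt_cauchyStress_comp hW (t := 0) (by simpa using hF) h1
  have h3 : (fun s : ℝ => cauchyStress W (F * NormedSpace.exp (s • A) * 1)) =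
      fun _ => cauchyStress W F := by
    funext s
    rw [Matrix.mul_one, cauchyStress_mul_right hW hF (exp_mem_SO3 (smul_skew hA s))]
  rw [h3] at h2
  simpa using h2.unique (hasDerivAt_const (0 : ℝ) _)

theorem fderiv_cauchyStress_conj (hW : IsIsotropicHyperelastic W) {F Q R : M3}
    (hF : F ∈ GLPlus3) (hQ : Q ∈ SO3) (hR : R ∈ SO3) (K : M3) :
    fderiv ℝ (cauchyStress W) (Q * F * R) (Q * K * R)
      = Q * fderiv ℝ (cauchyStress W) F K * Qᵀ := by
  have hF' : Q * F * R ∈ GLPlus3 :=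
    GLPlus3.mul_mem (GLPlus3.mul_mem (SO3.mem_GLPlus3 hQ) hF) (SO3.mem_GLPlus3 hR)
  have h1 : HasFDerivAt (fun G => cauchyStress W (mulLR Q R G))
      ((fderiv ℝ (cauchyStress W) (Q * F * R)).comp (mulLR Q R)) F :=
    HasFDerivAt.comp F (g := cauchyStress W)
      (cauchyStress_differentiableAt hW hF').hasFDerivAt (mulLR Q R).hasFDerivAt
  have h2 : HasFDerivAt (fun G => mulLR Q Qᵀ (cauchyStress W G))
      ((mulLR Q Qᵀ).comp (fderiv ℝ (cauchyStress W) F)) F :=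
    (mulLR Q Qᵀ).hasFDerivAt.comp F (cauchyStress_differentiableAt hW hF).hasFDerivAt
  have h3 : (fun G => cauchyStress W (mulLR Q R G)) =ᶠ[nhds F]
      fun G => mulLR Q Qᵀ (cauchyStress W G) := by
    filter_upwards [isOpen_GLPlus3.mem_nhds hF] with G hG
    exact cauchyStress_conj hW hG hQ hR
  exact DFunLike.congr_fun ((h1.congr_of_eventuallyEq h3.symm).unique h2) K

/-! ### Covariance and derivatives of `cauchyHat` -/

/-- The orthogonal projection of `ℝ³ˣ³` onto `Sym(3)`. -/
def symProj : M3 →L[ℝ] Sym3 :=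
  LinearMap.toContinuousLinearMap
    { toFun := fun X => ⟨symPart X, by
        rw [mem_Sym3]; simp [symPart, Matrix.transpose_smul, add_comm]⟩
      map_add' := fun X Y => Subtype.ext (by
        simp only [symPart, Matrix.transpose_add, Submodule.coe_add, ← smul_add]
        congr 1; abel)
      map_smul' := fun c X => Subtype.ext (by
        simp only [symPart, Matrix.transpose_smul, RingHom.id_apply, Submodule.coe_smul,
          ← smul_add]
        exact smul_comm _ _ _) }

theorem symPart_of_mem_Sym3 {X : M3} (hX : X ∈ Sym3) : symPart X = X := by
  rw [symPart, mem_Sym3.1 hX, ← two_smul ℝ X, smul_smul]; norm_num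

theorem symProj_coe (X : Sym3) : symProj (X : M3) = X :=
  Subtype.ext (symPart_of_mem_Sym3 X.2)

theorem conj_mem_Sym3 (Q : M3) {X : M3} (hX : X ∈ Sym3) : Q * X * Qᵀ ∈ Sym3 := by
  rw [mem_Sym3, Matrix.transpose_mul, Matrix.transpose_mul, Matrix.transpose_transpose,
    mem_Sym3.1 hX, Matrix.mul_assoc]

/-- Conjugation `X ↦ Q X Qᵀ` on `Sym(3)`. -/
def symConj (Q : M3) : Sym3 →L[ℝ] Sym3 := symProj.comp ((mulLR Q Qᵀ).comp Sym3.subtypeL)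

theorem coe_symConj (Q : M3) (X : Sym3) : (symConj Q X : M3) = Q * X * Qᵀ :=
  symPart_of_mem_Sym3 (conj_mem_Sym3 Q X.2)

theorem cauchyHat_symConj (hW : IsIsotropicHyperelastic W) {Q : M3} (hQ : Q ∈ SO3) (X : Sym3) :
    cauchyHat W (symConj Q X) = Q * cauchyHat W X * Qᵀ := by
  unfold cauchyHat
  rw [coe_symConj, exp_SO3_conj hQ,
    cauchyStress_conj hW (exp_mem_GLPlus3 _) hQ (SO3.transpose_mem hQ)]

theorem fderiv_cauchyHat_symConj (hW : IsIsotropicHyperelastic W) {Q : M3} (hQ : Q ∈ SO3)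
    (X H : Sym3) :
    fderiv ℝ (cauchyHat W) (symConj Q X) (symConj Q H)
      = Q * fderiv ℝ (cauchyHat W) X H * Qᵀ := by
  have h1 : HasFDerivAt (fun Y => cauchyHat W (symConj Q Y))
      ((fderiv ℝ (cauchyHat W) (symConj Q X)).comp (symConj Q)) X :=
    HasFDerivAt.comp X (g := cauchyHat W)
      (cauchyHat_differentiable hW _).hasFDerivAt (symConj Q).hasFDerivAt
  have h2 : HasFDerivAt (fun Y => mulLR Q Qᵀ (cauchyHat W Y))
      ((mulLR Q Qᵀ).comp (fderiv ℝ (cauchyHat W) X)) X :=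
    (mulLR Q Qᵀ).hasFDerivAt.comp X (cauchyHat_differentiable hW X).hasFDerivAt
  have h3 : (fun Y => cauchyHat W (symConj Q Y)) = fun Y => mulLR Q Qᵀ (cauchyHat W Y) :=
    funext fun Y => cauchyHat_symConj hW hQ Y
  rw [h3] at h1
  exact DFunLike.congr_fun (h1.unique h2) H

theorem hasDerivAt_cauchyHat_comp (hW : IsIsotropicHyperelastic W) {X : ℝ → Sym3} {X' : Sym3}
    {t : ℝ} (h : HasDerivAt X X' t) :
    HasDerivAt (fun s => cauchyHat W (X s)) (fderiv ℝ (cauchyHat W) (X t) X') t :=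
  (cauchyHat_differentiable hW (X t)).hasFDerivAt.comp_hasDerivAt t h

/-- The derivative of `σ̂` along the orbit of rotations. -/
theorem fderiv_cauchyHat_commutator (hW : IsIsotropicHyperelastic W) (X : Sym3) {A : M3}
    (hA : Aᵀ = -A) :
    fderiv ℝ (cauchyHat W) X (symProj (A * X - X * A))
      = A * cauchyHat W X - cauchyHat W X * A := by
  have h1 : HasDerivAt (fun s : ℝ => symConj (NormedSpace.exp (s • A)) X)
      (symProj (A * X - X * A)) 0 :=
    symProj.hasFDerivAt.comp_hasDerivAt (0 : ℝ) (hasDerivAt_exp_conj hA X)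
  have h2 := hasDerivAt_cauchyHat_comp hW h1
  have h3 : (fun s : ℝ => cauchyHat W (symConj (NormedSpace.exp (s • A)) X)) = fun s =>
      NormedSpace.exp (s • A) * cauchyHat W X * (NormedSpace.exp (s • A))ᵀ :=
    funext fun s => cauchyHat_symConj hW (exp_mem_SO3 (smul_skew hA s)) X
  have h0 : symConj (NormedSpace.exp ((0 : ℝ) • A)) X = X :=
    Subtype.ext (by rw [coe_symConj]; simp)
  rw [h3, h0] at h2
  exact h2.unique (hasDerivAt_exp_conj hA _)

/-- In commuting directions exp(X + sH) = exp(sH) exp X, so the derivative of the exponential is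
elementary. -/
theorem fderiv_cauchyHat_of_commute (hW : IsIsotropicHyperelastic W) {X H : Sym3}
    (hc : Commute (X : M3) (H : M3)) :
    fderiv ℝ (cauchyHat W) X H
      = fderiv ℝ (cauchyStress W) (NormedSpace.exp (X : M3))
          ((H : M3) * NormedSpace.exp (X : M3)) := by
  have h1 : HasDerivAt (fun s : ℝ => X + s • H) H 0 := by
    have h := ((hasDerivAt_id (0 : ℝ)).smul_const H).const_add X
    rw [one_smul] at h
    exact h
  have h2 := hasDerivAt_cauchyHat_comp hW h1
  have h3 := hasDerivAt_mulLR_exp 1 (NormedSpace.exp (X : M3)) H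
  have h4 := hasDerivAt_cauchyStress_comp hW (t := 0) (by simpa using exp_mem_GLPlus3 (X : M3)) h3
  have h5 : (fun s : ℝ => cauchyHat W (X + s • H)) = fun s : ℝ =>
      cauchyStress W (1 * NormedSpace.exp (s • (H : M3)) * NormedSpace.exp (X : M3)) := by
    funext s
    rw [cauchyHat, Submodule.coe_add, Submodule.coe_smul, add_comm,
      Matrix.exp_add_of_commute _ _ (hc.symm.smul_left s), Matrix.one_mul]
  rw [h5] at h2
  simpa using h2.unique h4

/-! ### The two bilinear forms on `Sym(3)` -/

theorem frobInner_add_left (X Y Z : M3) :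
    frobInner (X + Y) Z = frobInner X Z + frobInner Y Z := by
  simp [frobInner, Matrix.add_mul]

theorem frobInner_smul_left (c : ℝ) (X Z : M3) : frobInner (c • X) Z = c * frobInner X Z := by
  simp [frobInner]

theorem frobInner_add_right (X Y Z : M3) :
    frobInner X (Y + Z) = frobInner X Y + frobInner X Z := by
  simp [frobInner, Matrix.mul_add]

theorem frobInner_smul_right (c : ℝ) (X Z : M3) : frobInner X (c • Z) = c * frobInner X Z := by
  simp [frobInner]

/-- The form `(H, K) ↦ ⟨T H, K⟩` on `Sym(3)` of a linear map `T : Sym(3) → ℝ³ˣ³`. -/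
def frobForm (T : Sym3 →ₗ[ℝ] M3) : LinearMap.BilinForm ℝ Sym3 :=
  LinearMap.mk₂ ℝ (fun H K => frobInner (T H) K)
    (fun H H' K => by rw [map_add, frobInner_add_left])
    (fun c H K => by rw [map_smul, frobInner_smul_left, smul_eq_mul])
    (fun H K K' => by rw [Submodule.coe_add, frobInner_add_right])
    (fun c H K => by rw [Submodule.coe_smul, frobInner_smul_right, smul_eq_mul])

/-- The form `(H, K) ↦ ⟨Dσ(F).(H F), K⟩`. -/
def stressForm (W : M3 → ℝ) (F : M3) : LinearMap.BilinForm ℝ Sym3 :=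
  frobForm (((fderiv ℝ (cauchyStress W) F).comp ((mulLR 1 F).comp Sym3.subtypeL)).toLinearMap)

/-- The form `(H, K) ↦ ⟨Dσ̂(X).H, K⟩`. -/
def tangentForm (W : M3 → ℝ) (X : Sym3) : LinearMap.BilinForm ℝ Sym3 :=
  frobForm (fderiv ℝ (cauchyHat W) X).toLinearMap

theorem stressForm_apply (F : M3) (H K : Sym3) :
    stressForm W F H K = frobInner (fderiv ℝ (cauchyStress W) F ((H : M3) * F)) K := by
  change frobInner (fderiv ℝ (cauchyStress W) F (1 * (H : M3) * F)) K = _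
  rw [Matrix.one_mul]

theorem tangentForm_apply (X H K : Sym3) :
    tangentForm W X H K = frobInner (fderiv ℝ (cauchyHat W) X H) K := rfl

/-- Positive definiteness of the quadratic form of `B`. -/
def QuadPos (B : LinearMap.BilinForm ℝ Sym3) : Prop := ∀ H : Sym3, H ≠ 0 → 0 < B H H

theorem symTangentPosDef_iff (X : Sym3) : SymTangentPosDef W X ↔ QuadPos (tangentForm W X) := by
  unfold SymTangentPosDef QuadPos
  refine forall_congr' fun H => imp_congr_right fun _ => ?_
  rw [symTangent, tangentForm_apply, add_self_div_two]

/-! ### The Zaremba-Jaumann rate and CSP as positivity of `stressForm` -/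

theorem skewPart_transpose (X : M3) : (skewPart X)ᵀ = -skewPart X := by
  rw [skewPart, Matrix.transpose_smul, Matrix.transpose_sub, Matrix.transpose_transpose,
    ← smul_neg, neg_sub]

theorem symPart_add_skewPart (X : M3) : symPart X + skewPart X = X := by
  rw [symPart, skewPart, ← smul_add, add_add_sub_cancel, ← two_smul ℝ X, smul_smul]; norm_num

theorem symPart_mem_Sym3 (X : M3) : symPart X ∈ Sym3 := (symProj X).2

/-- The Zaremba-Jaumann rate of the Cauchy stress is `Dσ(F).(D F)`. -/
theorem zarembaJaumann_cauchyStress (hW : IsIsotropicHyperelastic W) {F : ℝ → M3} {t : ℝ}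
    (hd : DifferentiableAt ℝ F t) (ht : F t ∈ GLPlus3) :
    zarembaJaumann F (fun s => cauchyStress W (F s)) t
      = fderiv ℝ (cauchyStress W) (F t) (stretching F t * F t) := by
  have hu : IsUnit (F t).det := (ne_of_gt ht).isUnit
  have h1 := (hasDerivAt_cauchyStress_comp hW ht hd.hasDerivAt).deriv
  have h2 : deriv F t = stretching F t * F t + vorticity F t * F t := by
    rw [← Matrix.add_mul, stretching, vorticity, symPart_add_skewPart, velocityGradient,
      Matrix.mul_assoc, Matrix.nonsing_inv_mul _ hu, Matrix.mul_one]
  have h3 : zarembaJaumann F (fun s => cauchyStress W (F s)) t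
      = fderiv ℝ (cauchyStress W) (F t) (deriv F t)
        + cauchyStress W (F t) * vorticity F t - vorticity F t * cauchyStress W (F t) :=
    congrArg (fun Z : M3 => Z + cauchyStress W (F t) * vorticity F t
      - vorticity F t * cauchyStress W (F t)) h1
  -- The spin part contributes Wσ - σW, which cancels the corotational terms.
  rw [h3, h2, map_add, fderiv_cauchyStress_skew_mul hW ht (A := vorticity F t)
    (skewPart_transpose _)]
  abel

theorem CSPAt_iff (hW : IsIsotropicHyperelastic W) {F₀ : M3} (hF : F₀ ∈ GLPlus3) :
    CSPAt W F₀ ↔ QuadPos (stressForm W F₀) := by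
  constructor
  · intro h H hH
    -- This history has velocity gradient H at time 0: prescribed stretching and no spin.
    set F : ℝ → M3 := fun s => 1 * NormedSpace.exp (s • (H : M3)) * F₀ with hFdef
    have hu : IsUnit F₀.det := (ne_of_gt hF).isUnit
    have hd : ∀ s, DifferentiableAt ℝ F s := fun s =>
      (mulLR 1 F₀).differentiableAt.comp s
        (differentiable_exp_smul_const (𝕂 := ℝ) (H : M3) s)
    have h0 : F 0 = F₀ := by simp [hFdef]
    have hder : deriv F 0 = (H : M3) * F₀ := by
      have h1 := (hasDerivAt_mulLR_exp 1 F₀ (H : M3)).deriv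
      rw [Matrix.one_mul] at h1
      exact h1
    have hL : velocityGradient F 0 = (H : M3) := by
      rw [velocityGradient, hder, h0, Matrix.mul_assoc, Matrix.mul_nonsing_inv _ hu,
        Matrix.mul_one]
    have hS : stretching F 0 = (H : M3) := by
      rw [stretching, hL, symPart_of_mem_Sym3 H.2]
    have h1 := h F hd (fun s => GLPlus3.mul_mem (GLPlus3.mul_mem (SO3.mem_GLPlus3 (one_mem SO3))
      (exp_mem_GLPlus3 _)) hF) 0 h0
      (by rw [hS]; exact fun hc => hH (Subtype.ext hc))
    rw [zarembaJaumann_cauchyStress hW (hd 0) (by rw [h0]; exact hF), hS, h0] at h1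
    rwa [stressForm_apply]
  · intro h F hd hmem t ht hne
    have h1 := h ⟨stretching F t, symPart_mem_Sym3 _⟩ (fun hc => hne (congrArg Subtype.val hc))
    rw [stressForm_apply] at h1
    rwa [zarembaJaumann_cauchyStress hW (hd t) (hmem t), ht]

/-! ### Reduction to principal axes -/

theorem symConj_symConj_transpose {Q : M3} (hQ : Q ∈ SO3) (H : Sym3) :
    symConj Q (symConj Qᵀ H) = H := by
  apply Subtype.ext
  rw [coe_symConj, coe_symConj, Matrix.transpose_transpose]
  have : Q * (Qᵀ * (H : M3) * Q) * Qᵀ = (Q * Qᵀ) * (H : M3) * (Q * Qᵀ) := by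
    simp only [Matrix.mul_assoc]
  rw [this, SO3.mul_transpose hQ, Matrix.one_mul, Matrix.mul_one]

/-- Conjugation by Q is a bijection of `Sym3`, with inverse conjugation by Qᵀ. -/
theorem quadPos_congr_symConj {B C : LinearMap.BilinForm ℝ Sym3} {Q : M3} (hQ : Q ∈ SO3)
    (h : ∀ H, B (symConj Q H) (symConj Q H) = C H H) : QuadPos B ↔ QuadPos C := by
  constructor
  · intro hB H hH
    rw [← h]
    refine hB _ fun hc => hH ?_
    have h1 := symConj_symConj_transpose (SO3.transpose_mem hQ) H
    rw [Matrix.transpose_transpose, hc, map_zero] at h1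
    exact h1.symm
  · intro hC H hH
    rw [← symConj_symConj_transpose hQ H, h]
    refine hC _ fun hc => hH ?_
    rw [← symConj_symConj_transpose hQ H, hc, map_zero]

theorem stressForm_symConj (hW : IsIsotropicHyperelastic W) {F Q R : M3}
    (hF : F ∈ GLPlus3) (hQ : Q ∈ SO3) (hR : R ∈ SO3) (H K : Sym3) :
    stressForm W (Q * F * R) (symConj Q H) (symConj Q K) = stressForm W F H K := by
  rw [stressForm_apply, stressForm_apply, coe_symConj, coe_symConj]
  have h : Q * (H : M3) * Qᵀ * (Q * F * R) = Q * ((H : M3) * F) * R := by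
    have : Q * (H : M3) * Qᵀ * (Q * F * R) = Q * (H : M3) * (Qᵀ * Q) * (F * R) := by
      simp only [Matrix.mul_assoc]
    rw [this, SO3.transpose_mul hQ, Matrix.mul_one]
    simp only [Matrix.mul_assoc]
  rw [h, fderiv_cauchyStress_conj hW hF hQ hR, frobInner_conj hQ (SO3.transpose_mem hQ)]

theorem tangentForm_symConj (hW : IsIsotropicHyperelastic W) {Q : M3} (hQ : Q ∈ SO3)
    (X H K : Sym3) :
    tangentForm W (symConj Q X) (symConj Q H) (symConj Q K) = tangentForm W X H K := by
  rw [tangentForm_apply, tangentForm_apply, fderiv_cauchyHat_symConj hW hQ, coe_symConj,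
    frobInner_conj hQ (SO3.transpose_mem hQ)]

/-! ### Diagonal and shear components; half turns -/

/-- Diagonal matrices as elements of `Sym(3)`. -/
def symDiag (v : Fin 3 → ℝ) : Sym3 := ⟨Matrix.diagonal v, Matrix.diagonal_transpose v⟩

/-- The symmetric shear `eᵢ ⊗ eⱼ + eⱼ ⊗ eᵢ`. -/
def symShear (i j : Fin 3) : Sym3 :=
  ⟨Matrix.single i j 1 + Matrix.single j i 1, by
    rw [mem_Sym3, Matrix.transpose_add, Matrix.transpose_single, Matrix.transpose_single,
      add_comm]⟩

theorem Sym3.eq_symDiag_add_symShear (H : Sym3) :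
    H = symDiag (fun i => (H : M3) i i) + (H : M3) 0 1 • symShear 0 1
      + (H : M3) 0 2 • symShear 0 2 + (H : M3) 1 2 • symShear 1 2 := by
  have h : ∀ i j, (H : M3) j i = (H : M3) i j := fun i j => congrFun (congrFun H.2 i) j
  apply Subtype.ext
  ext i j
  fin_cases i <;> fin_cases j <;>
    simp [symDiag, symShear, h 0 1, h 0 2, h 1 2]

/-- The rotation by `π` about the `k`-th axis. -/
def halfTurn (k : Fin 3) : M3 := Matrix.diagonal fun i => if i = k then 1 else -1

theorem halfTurn_transpose (k : Fin 3) : (halfTurn k)ᵀ = halfTurn k :=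
  Matrix.diagonal_transpose _

theorem halfTurn_mul_diagonal_mul (k : Fin 3) (v : Fin 3 → ℝ) :
    halfTurn k * Matrix.diagonal v * (halfTurn k)ᵀ = Matrix.diagonal v := by
  rw [halfTurn_transpose, halfTurn, Matrix.diagonal_mul_diagonal, Matrix.diagonal_mul_diagonal]
  congr 1
  funext i
  split_ifs <;> ring

theorem halfTurn_mem_SO3 (k : Fin 3) : halfTurn k ∈ SO3 := by
  refine mem_SO3 (by simpa using halfTurn_mul_diagonal_mul k 1) ?_
  rw [halfTurn, Matrix.det_diagonal, Fin.prod_univ_three]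
  fin_cases k <;> simp

theorem symConj_halfTurn_symDiag (k : Fin 3) (v : Fin 3 → ℝ) :
    symConj (halfTurn k) (symDiag v) = symDiag v :=
  Subtype.ext (by rw [coe_symConj]; exact halfTurn_mul_diagonal_mul k v)

theorem symConj_halfTurn_symShear (k i j : Fin 3) :
    symConj (halfTurn k) (symShear i j)
      = ((if i = k then 1 else -1) * (if j = k then 1 else -1) : ℝ) • symShear i j := by
  apply Subtype.ext
  rw [coe_symConj, halfTurn_transpose, halfTurn, Submodule.coe_smul]
  change _ * (Matrix.single i j 1 + Matrix.single j i 1) * _ = _ • (_ + _)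
  ext a b
  rw [Matrix.mul_diagonal, Matrix.diagonal_mul, Matrix.smul_apply, Matrix.add_apply,
    Matrix.single_apply, Matrix.single_apply, smul_eq_mul]
  by_cases h1 : i = a ∧ j = b
  · obtain ⟨rfl, rfl⟩ := h1; ring
  · by_cases h2 : j = a ∧ i = b
    · obtain ⟨rfl, rfl⟩ := h2; ring
    · rw [if_neg h1, if_neg h2]; ring

/-- Invariance of a form under the half turns about the coordinate axes. -/
def HalfTurnInvariant (B : LinearMap.BilinForm ℝ Sym3) : Prop :=
  ∀ k H K, B (symConj (halfTurn k) H) (symConj (halfTurn k) K) = B H K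

/-- Any two of the four components of H have opposite parity under some half turn, so invariance
makes their mixed terms vanish. The form need not be symmetric, so both orders of arguments are
needed. -/
theorem HalfTurnInvariant.apply_self {B : LinearMap.BilinForm ℝ Sym3} (hB : HalfTurnInvariant B)
    (H : Sym3) :
    B H H = B (symDiag fun i => (H : M3) i i) (symDiag fun i => (H : M3) i i)
      + (H : M3) 0 1 ^ 2 * B (symShear 0 1) (symShear 0 1)
      + (H : M3) 0 2 ^ 2 * B (symShear 0 2) (symShear 0 2)
      + (H : M3) 1 2 ^ 2 * B (symShear 1 2) (symShear 1 2) := by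
  have key : ∀ k {U V : Sym3}, symConj (halfTurn k) U = U → symConj (halfTurn k) V = -V →
      B U V = 0 ∧ B V U = 0 := by
    intro k U V hU hV
    have h1 := hB k U V
    have h2 := hB k V U
    rw [hU, hV, map_neg] at h1
    rw [hU, hV, map_neg, LinearMap.neg_apply] at h2
    constructor <;> linarith
  have p01 : symConj (halfTurn 2) (symShear 0 1) = symShear 0 1 := by
    rw [symConj_halfTurn_symShear]; simp
  have p02 : symConj (halfTurn 1) (symShear 0 2) = symShear 0 2 := by
    rw [symConj_halfTurn_symShear]; simp
  have n01 : symConj (halfTurn 1) (symShear 0 1) = -symShear 0 1 := by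
    rw [symConj_halfTurn_symShear, ← neg_one_smul ℝ (symShear 0 1)]; congr 1; simp
  have n02 : symConj (halfTurn 2) (symShear 0 2) = -symShear 0 2 := by
    rw [symConj_halfTurn_symShear, ← neg_one_smul ℝ (symShear 0 2)]; congr 1; simp
  have n12 : symConj (halfTurn 2) (symShear 1 2) = -symShear 1 2 := by
    rw [symConj_halfTurn_symShear, ← neg_one_smul ℝ (symShear 1 2)]; congr 1; simp
  have n12' : symConj (halfTurn 1) (symShear 1 2) = -symShear 1 2 := by
    rw [symConj_halfTurn_symShear, ← neg_one_smul ℝ (symShear 1 2)]; congr 1; simp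
  set d := symDiag fun i => (H : M3) i i with hd
  have k1 := key 1 (symConj_halfTurn_symDiag 1 fun i => (H : M3) i i) n01
  have k2 := key 2 (symConj_halfTurn_symDiag 2 fun i => (H : M3) i i) n02
  have k3 := key 2 (symConj_halfTurn_symDiag 2 fun i => (H : M3) i i) n12
  have k4 := key 2 p01 n02
  have k5 := key 2 p01 n12
  have k6 := key 1 p02 n12'
  rw [← hd] at k1 k2 k3
  conv_lhs => rw [Sym3.eq_symDiag_add_symShear H, ← hd]
  simp only [map_add, map_smul, LinearMap.add_apply, LinearMap.smul_apply, smul_eq_mul,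
    k1.1, k1.2, k2.1, k2.2, k3.1, k3.2, k4.1, k4.2, k5.1, k5.2, k6.1, k6.2]
  ring

theorem symShear_ne_zero {i j : Fin 3} (hij : i ≠ j) : symShear i j ≠ 0 := by
  intro h
  have h1 := congrFun (congrFun (congrArg Subtype.val h) i) j
  simp [symShear, hij.symm] at h1

/-- After the splitting, positivity needs only the diagonal form and the three shear coefficients;
the diagonal term is nonnegative, and any nonzero off-diagonal entry makes the sum positive. -/
theorem QuadPos.of_halfTurnInvariant {B C : LinearMap.BilinForm ℝ Sym3} (hBpos : QuadPos B)
    (hC : HalfTurnInvariant C)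
    (hd : ∀ v, C (symDiag v) (symDiag v) = B (symDiag v) (symDiag v))
    (hs : ∀ i j, i ≠ j → 0 < B (symShear i j) (symShear i j) →
      0 < C (symShear i j) (symShear i j)) : QuadPos C := by
  intro H hH
  have hp : ∀ i j, i ≠ j → 0 < C (symShear i j) (symShear i j) := fun i j hij =>
    hs i j hij (hBpos _ (symShear_ne_zero hij))
  have p01 := hp 0 1 (by decide)
  have p02 := hp 0 2 (by decide)
  have p12 := hp 1 2 (by decide)
  have hd0 : 0 ≤ B (symDiag fun i => (H : M3) i i) (symDiag fun i => (H : M3) i i) := by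
    by_cases h : symDiag (fun i => (H : M3) i i) = 0
    · rw [h, map_zero]
    · exact (hBpos _ h).le
  rw [hC.apply_self, hd]
  by_cases h01 : (H : M3) 0 1 = 0
  · by_cases h02 : (H : M3) 0 2 = 0
    · by_cases h12 : (H : M3) 1 2 = 0
      · have h : symDiag (fun i => (H : M3) i i) ≠ 0 := by
          intro h
          apply hH
          rw [Sym3.eq_symDiag_add_symShear H, h, h01, h02, h12]
          simp
        have := hBpos _ h
        rw [h01, h02, h12]
        linarith
      · positivity
    · positivity
  · positivity

/-! ### The shear components in principal axes -/

theorem infinitesimal_rotation_transpose (i j : Fin 3) :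
    (Matrix.single i j 1 - Matrix.single j i 1 : M3)ᵀ
      = -(Matrix.single i j 1 - Matrix.single j i 1) := by
  simp

/-- Used with w = -v for the commutator with log V, and with w = ωv for a left rotation of V
combined with a right one. -/
theorem infinitesimal_rotation_mul_diagonal (i j : Fin 3) (v w : Fin 3 → ℝ) :
    (Matrix.single i j 1 - Matrix.single j i 1 : M3) * Matrix.diagonal v
        + Matrix.diagonal w * (Matrix.single i j 1 - Matrix.single j i 1)
      = Matrix.single i j (v j + w i) + Matrix.single j i (-(v i + w j)) := by
  ext a b
  rw [Matrix.add_apply, Matrix.mul_diagonal, Matrix.diagonal_mul]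
  simp only [Matrix.sub_apply, Matrix.single_apply]
  by_cases h1 : i = a ∧ j = b
  · obtain ⟨rfl, rfl⟩ := h1
    by_cases h : j = i ∧ i = j
    · simp [h.1]
    · simp [h]
  · by_cases h2 : j = a ∧ i = b
    · obtain ⟨rfl, rfl⟩ := h2
      simp [h1]; ring
    · simp [h1, h2]

theorem symShear_mul_diagonal (i j : Fin 3) (v : Fin 3 → ℝ) :
    (symShear i j : M3) * Matrix.diagonal v
      = Matrix.single i j (v j) + Matrix.single j i (v i) := by
  change (Matrix.single i j 1 + Matrix.single j i 1) * _ = _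
  ext a b
  rw [Matrix.mul_diagonal]
  simp only [Matrix.add_apply, Matrix.single_apply]
  by_cases h1 : i = a ∧ j = b
  · obtain ⟨rfl, rfl⟩ := h1
    by_cases h : j = i ∧ i = j
    · simp [h.1]; ring
    · simp [h]
  · by_cases h2 : j = a ∧ i = b
    · obtain ⟨rfl, rfl⟩ := h2
      simp [h1]
    · simp [h1, h2]

theorem commute_symDiag_symShear {i j : Fin 3} {x : Fin 3 → ℝ} (h : x i = x j) :
    Commute (symDiag x : M3) (symShear i j : M3) := by
  have h1 := symShear_mul_diagonal i j x
  have h2 := congrArg Matrix.transpose h1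
  rw [Matrix.transpose_mul, Matrix.diagonal_transpose, Sym3.transpose_coe,
    Matrix.transpose_add, Matrix.transpose_single, Matrix.transpose_single, ← h] at h2
  change Matrix.diagonal x * _ = _ * Matrix.diagonal x
  rw [h1, h2, h, add_comm]

/-- With A the infinitesimal rotation in the (i, j) plane, the commutator [A, log V] is (x j - x i)
times the shear, while δ · shear · V = AV + V(ωA). Dσ̂ sends the first to Aσ - σA by covariance; Dσ
sends the second to the same value, as the right rotation does not change σ. -/
theorem tangentForm_symShear (hW : IsIsotropicHyperelastic W) (x : Fin 3 → ℝ) {i j : Fin 3} :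
    let l : Fin 3 → ℝ := fun i => Real.exp (x i)
    (x j - x i) * tangentForm W (symDiag x) (symShear i j) (symShear i j)
      = (l j ^ 2 - l i ^ 2) / (l i ^ 2 + l j ^ 2) *
        stressForm W (NormedSpace.exp (symDiag x : M3)) (symShear i j) (symShear i j) := by
  intro l
  set A : M3 := Matrix.single i j 1 - Matrix.single j i 1 with hAdef
  have hA : Aᵀ = -A := infinitesimal_rotation_transpose i j
  set V : M3 := NormedSpace.exp (symDiag x : M3) with hVdef
  have hV : V = Matrix.diagonal l := exp_diagonal_real x
  have hVmem : V ∈ GLPlus3 := exp_mem_GLPlus3 _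
  have hpos : ∀ k, 0 < l k := fun k => Real.exp_pos _
  have hi := hpos i
  have hj := hpos j
  have h1 : A * (symDiag x : M3) - (symDiag x : M3) * A = (x j - x i) • (symShear i j : M3) := by
    have h := infinitesimal_rotation_mul_diagonal i j x (-x)
    have hx : Matrix.diagonal (-x) = -Matrix.diagonal x := (Matrix.diagonal_neg x).symm
    rw [← hAdef, hx, Matrix.neg_mul, ← sub_eq_add_neg] at h
    change A * Matrix.diagonal x - Matrix.diagonal x * A
      = _ • (Matrix.single i j 1 + Matrix.single j i 1)
    rw [h, smul_add, Matrix.smul_single, Matrix.smul_single, Pi.neg_apply, Pi.neg_apply]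
    congr 2 <;> simp only [smul_eq_mul] <;> ring
  have h2 : (x j - x i) • fderiv ℝ (cauchyHat W) (symDiag x) (symShear i j)
      = A * cauchyStress W V - cauchyStress W V * A := by
    have h := fderiv_cauchyHat_commutator hW (symDiag x) hA
    rw [h1, map_smul, symProj_coe, map_smul] at h
    exact h
  -- The pair (δ, ω) solves l j + ω l i = δ l j and -(l i + ω l j) = δ l i, the two entries of `h3`.
  set ω : ℝ := -(2 * l i * l j) / (l i ^ 2 + l j ^ 2) with hω
  set δ : ℝ := (l j ^ 2 - l i ^ 2) / (l i ^ 2 + l j ^ 2) with hδ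
  have h3 : δ • ((symShear i j : M3) * V) = A * V + V * (ω • A) := by
    have h := infinitesimal_rotation_mul_diagonal i j l (ω • l)
    have hx : Matrix.diagonal (ω • l) = ω • Matrix.diagonal l := Matrix.diagonal_smul ω l
    rw [← hAdef, hx, Matrix.smul_mul] at h
    rw [Matrix.mul_smul, hV, h, symShear_mul_diagonal, smul_add, Matrix.smul_single,
      Matrix.smul_single]
    congr 2 <;> simp only [Pi.smul_apply, smul_eq_mul, hδ, hω] <;> field_simp <;> ring
  have h4 : δ • fderiv ℝ (cauchyStress W) V ((symShear i j : M3) * V)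
      = A * cauchyStress W V - cauchyStress W V * A := by
    rw [← map_smul, h3, map_add, fderiv_cauchyStress_skew_mul hW hVmem hA,
      fderiv_cauchyStress_mul_skew hW hVmem (smul_skew hA ω), add_zero]
  rw [tangentForm_apply, stressForm_apply, ← frobInner_smul_left, ← frobInner_smul_left, h2, h4]

theorem tangentForm_symShear_pos_iff (hW : IsIsotropicHyperelastic W) (x : Fin 3 → ℝ)
    (i j : Fin 3) :
    0 < tangentForm W (symDiag x) (symShear i j) (symShear i j) ↔
      0 < stressForm W (NormedSpace.exp (symDiag x : M3)) (symShear i j) (symShear i j) := by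
  have h := tangentForm_symShear hW x (i := i) (j := j)
  have hden : 0 < Real.exp (x i) ^ 2 + Real.exp (x j) ^ 2 := by positivity
  rcases lt_trichotomy (x i) (x j) with hlt | heq | hgt
  · have h1 : 0 < x j - x i := sub_pos.2 hlt
    have h2 : 0 < (Real.exp (x j) ^ 2 - Real.exp (x i) ^ 2)
        / (Real.exp (x i) ^ 2 + Real.exp (x j) ^ 2) :=
      div_pos (sub_pos.2 (pow_lt_pow_left₀ (Real.exp_lt_exp.2 hlt) (Real.exp_pos _).le
        two_ne_zero)) hden
    rw [← mul_pos_iff_of_pos_left h1, h, mul_pos_iff_of_pos_left h2]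
  -- Here the identity `h` degenerates to 0 = 0; the shear commutes with log V instead.
  · rw [tangentForm_apply, stressForm_apply,
      fderiv_cauchyHat_of_commute hW (commute_symDiag_symShear heq)]
  · have h1 : x j - x i < 0 := sub_neg.2 hgt
    have h2 : (Real.exp (x j) ^ 2 - Real.exp (x i) ^ 2)
        / (Real.exp (x i) ^ 2 + Real.exp (x j) ^ 2) < 0 :=
      div_neg_of_neg_of_pos (sub_neg.2 (pow_lt_pow_left₀ (Real.exp_lt_exp.2 hgt)
        (Real.exp_pos _).le two_ne_zero)) hden
    rw [← neg_inj, ← neg_mul, ← neg_mul] at h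
    rw [← mul_pos_iff_of_pos_left (neg_pos.2 h1), h, mul_pos_iff_of_pos_left (neg_pos.2 h2)]

theorem tangentForm_symDiag (hW : IsIsotropicHyperelastic W) (x v : Fin 3 → ℝ) :
    tangentForm W (symDiag x) (symDiag v) (symDiag v)
      = stressForm W (NormedSpace.exp (symDiag x : M3)) (symDiag v) (symDiag v) := by
  rw [tangentForm_apply, stressForm_apply,
    fderiv_cauchyHat_of_commute hW (Matrix.commute_diagonal x v)]

theorem tangentForm_halfTurnInvariant (hW : IsIsotropicHyperelastic W) (x : Fin 3 → ℝ) :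
    HalfTurnInvariant (tangentForm W (symDiag x)) := by
  intro k H K
  have h := tangentForm_symConj hW (halfTurn_mem_SO3 k) (symDiag x) H K
  rwa [symConj_halfTurn_symDiag] at h

theorem stressForm_halfTurnInvariant (hW : IsIsotropicHyperelastic W) (x : Fin 3 → ℝ) :
    HalfTurnInvariant (stressForm W (NormedSpace.exp (symDiag x : M3))) := by
  intro k H K
  have h := stressForm_symConj hW (exp_mem_GLPlus3 (symDiag x : M3)) (halfTurn_mem_SO3 k)
    (SO3.transpose_mem (halfTurn_mem_SO3 k)) H K
  have hV : NormedSpace.exp (symDiag x : M3) = Matrix.diagonal _ := exp_diagonal_real x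
  rwa [hV, halfTurn_mul_diagonal_mul, ← hV] at h

/-! ### From principal axes to arbitrary states -/

theorem quadPos_stressForm_exp_symDiag_iff (hW : IsIsotropicHyperelastic W) (x : Fin 3 → ℝ) :
    QuadPos (stressForm W (NormedSpace.exp (symDiag x : M3)))
      ↔ QuadPos (tangentForm W (symDiag x)) :=
  ⟨fun h => h.of_halfTurnInvariant (tangentForm_halfTurnInvariant hW x)
      (tangentForm_symDiag hW x) fun i j _ => (tangentForm_symShear_pos_iff hW x i j).2,
    fun h => h.of_halfTurnInvariant (stressForm_halfTurnInvariant hW x)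
      (fun v => (tangentForm_symDiag hW x v).symm)
      fun i j _ => (tangentForm_symShear_pos_iff hW x i j).1⟩

theorem quadPos_stressForm_iff (hW : IsIsotropicHyperelastic W) {F : M3} (hF : F ∈ GLPlus3) :
    QuadPos (stressForm W F) ↔ QuadPos (tangentForm W (logV F)) := by
  obtain ⟨R, hR, hFR⟩ := exists_polar hF
  obtain ⟨Q, hQ, x, hx, -⟩ := exists_SO3_diagonalization (logV F).2
  have hlog : logV F = symConj Q (symDiag x) := Subtype.ext (by rw [coe_symConj]; exact hx)
  -- The rotation Qᵀ R on the right is absorbed by isotropy; Q on the left acts by conjugation.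
  have hFx : F = Q * NormedSpace.exp (symDiag x : M3) * (Qᵀ * R) := by
    conv_lhs => rw [hFR, hlog, coe_symConj, exp_SO3_conj hQ]
    simp only [Matrix.mul_assoc]
  have h1 : QuadPos (stressForm W F) ↔
      QuadPos (stressForm W (NormedSpace.exp (symDiag x : M3))) := by
    refine quadPos_congr_symConj hQ fun H => ?_
    rw [hFx]
    exact stressForm_symConj hW (exp_mem_GLPlus3 _) hQ (mul_mem (SO3.transpose_mem hQ) hR) H H
  have h2 : QuadPos (tangentForm W (logV F)) ↔ QuadPos (tangentForm W (symDiag x)) := by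
    refine quadPos_congr_symConj hQ fun H => ?_
    rw [hlog]
    exact tangentForm_symConj hW hQ _ H H
  rw [h1, h2, quadPos_stressForm_exp_symDiag_iff hW x]

end

theorem mainTheorem2 (W : M3 → ℝ) (hW : IsIsotropicHyperelastic W) :
    ((∀ F ∈ GLPlus3, cauchyStress W F ∈ Sym3 ∧ cauchyHat W (logV F) = cauchyStress W F) ∧
      Differentiable ℝ (cauchyHat W)) ∧
    (∀ F ∈ GLPlus3, (CSPAt W F ↔ SymTangentPosDef W (logV F))) ∧
    (CSP W ↔ TSTSMpp W) := by
  have hpt : ∀ F ∈ GLPlus3, (CSPAt W F ↔ SymTangentPosDef W (logV F)) := fun F hF => by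
    rw [CSPAt_iff hW hF, symTangentPosDef_iff, quadPos_stressForm_iff hW hF]
  refine ⟨⟨fun F hF => ⟨cauchyStress_mem_Sym3 hW hF, cauchyHat_logV hW hF⟩,
    cauchyHat_differentiable hW⟩, hpt, fun h X => ?_, fun h F hF => (hpt F hF).2 (h _)⟩
  -- The state exp X has logarithmic strain X.
  have h1 := (hpt _ (exp_mem_GLPlus3 (X : M3))).1 (h _ (exp_mem_GLPlus3 (X : M3)))
  rwa [logV_exp] at h1
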